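/- Let $\mathcal S$ be a stabilizer on $n$ qubits, i.e. an abelian subgroup of the $n$-qubit Pauli group (all operators $\alpha R_1\otimes\cdots\otimes R_n$ with $\alpha\in\{\pm1,\pm i\}$ and $R_j\in\{I,X,Y,Z\}$) with $-I\notin\mathcal S$, and let $Q$ be the stabilizer code it defines, with orthogonal projector $P_Q=\frac1{|\mathcal S|}\sum_{R\in\mathcal S}R$ and $k$ logical qubits, $|\mathcal S|=2^{n-k}$. Assume that $Q$ is free of Bell pairs (it is not a tensor product of a $[[2,0,2]]$ code on two of the qubits and a stabilizer code on the remaining ones) and free of trivially encoded qubits (for every $j$ some $R\in\mathcal S$ has $R_j\ne I$). Fix any choice of logical qubits, i.e. Pauli operators $\bar X_1,\bar Z_1,\dots,\bar X_k,\bar Z_k$ that commute with all of $\mathcal S$, square to $I$ and satisfy the commutation relations of the Pauli operators $X_1,Z_1,\dots,X_k,Z_k$ on $k$ qubits. For $U=c_0I+c_1X+c_2XZ+c_3Z\in SU(2)$ let $\bar U_s=c_0I+c_1\bar X_s+c_2\bar X_s\bar Z_s+c_3\bar Z_s$, which acts as $U$ on logical qubit $s$ and trivially on the other logical qubits of $Q$.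 For $r\ge1$ let $\mathrm{Trans}(Q^{\otimes r})$ be the set of transversal gates on $r$ blocks: the unitaries in $SU(2^{nr})$ that commute with $P_Q^{\otimes r}$ and have the form $\bigotimes_{j=1}^nU_j$, where $U_j\in SU(2^r)$ acts on the $j$th qubit of each block. Then, for every $r\ge1$, $\mathrm{Trans}(Q^{\otimes r})$ is not encoded computationally universal for even one of the logical qubits of $Q$, not even approximately, for one-qubit gates only, and up to global phases. Precisely: for every logical qubit $s\in\{1,\dots,k\}$, every number $N\ge1$ of blocks and every block $b\le N$, it is not the case that for all $U\in SU(2)$ and all $\epsilon>0$ there are a number $c\in\mathbb C$ with $|c|=1$ and finitely many operators $V_1,\dots,V_\eta$ on $N$ blocks, each a gate of $\mathrm{Trans}(Q^{\otimes r})$ applied to some $r$ distinct blocks and the identity on the others, with $$\Big\|\bar U_s^{(b)}P_Q^{\otimes N}-c\,V_1V_2\cdots V_\eta\,P_Q^{\otimes N}\Big\|<\epsilon ,$$ where $\bar U_s^{(b)}$ is $\bar U_s$ on block $b$ and the identity on the other blocks, and $\|\cdot\|$ is the operator norm. -/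

import Mathlib

open scoped Matrix.Norms.L2Operator

noncomputable section

namespace StabCode

/-- The space of operators on qubits labelled by `Fin n`, as matrices in the computational basis
`Fin n → Fin 2`. -/
abbrev Op (n : ℕ) : Type := Matrix (Fin n → Fin 2) (Fin n → Fin 2) ℂ

/-- Operators on `r` blocks of `n` qubits each. The basis vector `x` has bit `x b j` at the
`j`-th qubit of block `b`. -/
abbrev BlockOp (r n : ℕ) : Type :=
  Matrix (Fin r → Fin n → Fin 2) (Fin r → Fin n → Fin 2) ℂ

/-- The tensor (Kronecker) product `⨂ i, A i` of a finite family of square matrices. -/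
def kron {ι α : Type*} [Fintype ι] (A : ι → Matrix α α ℂ) : Matrix (ι → α) (ι → α) ℂ :=
  Matrix.of fun x y => ∏ i, A i (x i) (y i)

/-- The matrices `I, X, Y, Z`, in this order. -/
def pauli : Fin 4 → Matrix (Fin 2) (Fin 2) ℂ :=
  ![1, !![0, 1; 1, 0], !![0, -Complex.I; Complex.I, 0], !![1, 0; 0, -1]]

/-- `M = a • (R_1 ⊗ ⋯ ⊗ R_n)` with a phase `a ∈ {±1, ±i}` and `R_i` the Pauli matrix number `p i`. -/
def IsPauliForm {n : ℕ} (M : Op n) (a : ℂ) (p : Fin n → Fin 4) : Prop :=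
  (a = 1 ∨ a = -1 ∨ a = Complex.I ∨ a = -Complex.I) ∧ M = a • kron (fun i => pauli (p i))

/-- Membership in the `n`-qubit Pauli group. -/
def IsPauli {n : ℕ} (M : Op n) : Prop := ∃ a p, IsPauliForm M a p

/-- The support of a Pauli operator: the positions at which its tensor factor is not the identity
(the tensor factors are determined by the operator). -/
def supp {n : ℕ} (M : Op n) : Set (Fin n) := {i | ∃ a p, IsPauliForm M a p ∧ p i ≠ 0}

/-- The operator `⨂ j, u j`, in which `u j` acts on the `j`-th qubit of each of the `r` blocks. -/
def transversal {r n : ℕ} (u : Fin n → Op r) : BlockOp r n :=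
  (kron u).submatrix Function.swap Function.swap

/-- The gate `U` on `r` blocks, applied to the distinct blocks `e 0, …, e (r-1)` out of `N` blocks,
and the identity on the remaining blocks. -/
def place {r N n : ℕ} (e : Fin r ↪ Fin N) (U : BlockOp r n) : BlockOp N n :=
  open Classical in
  Matrix.of fun x y =>
    if ∀ b, b ∉ Set.range e → x b = y b then U (fun i => x (e i)) (fun i => y (e i)) else 0

end StabCode

/-- An `n`-qubit stabilizer code, given by its stabilizer: an abelian subgroup of the Pauli group
that does not contain `-I`. -/
structure StabilizerCode (n : ℕ) where
  stab : Subgroup (Matrix.unitaryGroup (Fin n → Fin 2) ℂ)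
  isPauli : ∀ R ∈ stab, StabCode.IsPauli (R : StabCode.Op n)
  comm : ∀ R ∈ stab, ∀ T ∈ stab, R * T = T * R
  neg_one_notMem : ∀ R ∈ stab, (R : StabCode.Op n) ≠ -1

namespace StabilizerCode

open StabCode

variable {n : ℕ} (Q : StabilizerCode n)

theorem finite_stab : Finite Q.stab := by
  let f : Fin 4 × (Fin n → Fin 4) → Op n := fun q =>
    (![1, -1, Complex.I, -Complex.I] q.1 : ℂ) • kron (fun i => pauli (q.2 i))
  have h : ∀ R : Q.stab, ∃ q, f q = (R : Matrix.unitaryGroup (Fin n → Fin 2) ℂ) := by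
    rintro ⟨R, hR⟩
    obtain ⟨a, p, ha, hM⟩ := Q.isPauli R hR
    rcases ha with rfl | rfl | rfl | rfl
    · exact ⟨(0, p), hM.symm⟩
    · exact ⟨(1, p), hM.symm⟩
    · exact ⟨(2, p), hM.symm⟩
    · exact ⟨(3, p), hM.symm⟩
  choose g hg using h
  refine Finite.of_injective g fun R T hRT => ?_
  have := (hg R).symm.trans ((congrArg f hRT).trans (hg T))
  exact Subtype.ext (Subtype.ext this)

instance instFintypeStab : Fintype Q.stab :=
  haveI := Q.finite_stab
  Fintype.ofFinite _

/-- The code space: the joint `+1` eigenspace of the stabilizer. -/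
def codeSpace : Submodule ℂ ((Fin n → Fin 2) → ℂ) where
  carrier := {ψ | ∀ R ∈ Q.stab, (R : Op n).mulVec ψ = ψ}
  add_mem' := fun ha hb R hR => by rw [Matrix.mulVec_add, ha R hR, hb R hR]
  zero_mem' := fun R _ => Matrix.mulVec_zero _
  smul_mem' := fun c ψ h R hR => by rw [Matrix.mulVec_smul, h R hR]

/-- The orthogonal projector onto the code space, `P_Q = |S|⁻¹ ∑_{R ∈ S} R`. -/
def proj : Op n :=
  ((Fintype.card Q.stab : ℂ))⁻¹ •
    ∑ R : Q.stab, ((R : Matrix.unitaryGroup (Fin n → Fin 2) ℂ) : Op n)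

theorem mul_proj (T : Matrix.unitaryGroup (Fin n → Fin 2) ℂ) (hT : T ∈ Q.stab) :
    (T : Op n) * Q.proj = Q.proj := by
  rw [proj, Matrix.mul_smul, Finset.mul_sum]
  congr 1
  exact Fintype.sum_equiv (Equiv.mulLeft (⟨T, hT⟩ : Q.stab)) _ _ fun _ => rfl

/-- The vectors fixed by the projector `P_Q` are exactly the vectors of the code space. -/
theorem proj_mulVec_eq_self_iff (ψ : (Fin n → Fin 2) → ℂ) :
    Q.proj.mulVec ψ = ψ ↔ ψ ∈ Q.codeSpace := by
  constructor
  · intro h R hR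
    rw [← h, Matrix.mulVec_mulVec, Q.mul_proj R hR]
  · intro h
    have hc : (Fintype.card Q.stab : ℂ) ≠ 0 := Nat.cast_ne_zero.2 Fintype.card_ne_zero
    rw [proj, Matrix.smul_mulVec, Matrix.sum_mulVec,
      Finset.sum_congr rfl fun (R : Q.stab) _ => h R R.2, Finset.sum_const, Finset.card_univ,
      ← Nat.cast_smul_eq_nsmul ℂ, smul_smul, inv_mul_cancel₀ hc, one_smul]

/-- The projector `P_Q^{⊗ r}` onto the code `Q^{⊗ r}` on `r` blocks. -/
def blockProj (r : ℕ) : BlockOp r n := kron (fun _ : Fin r => Q.proj)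

/-- `Q` is a tensor product of a Bell pair (a `[[2,0,2]]` code) on the qubits `i, j` and a
stabilizer code on the other qubits: the stabilizer is the product of its subgroups supported on
`{i, j}` and on the complement, and the former has four elements, all of which but the identity
have support `{i, j}`. -/
def HasBellPair : Prop :=
  ∃ i j : Fin n, i ≠ j ∧
    Nat.card {R : Matrix.unitaryGroup (Fin n → Fin 2) ℂ //
      R ∈ Q.stab ∧ supp (R : Op n) ⊆ {i, j}} = 4 ∧
    (∀ R ∈ Q.stab, supp (R : Op n) ⊆ {i, j} → R ≠ 1 → supp (R : Op n) = {i, j}) ∧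
    ∀ R ∈ Q.stab, ∃ R₁ ∈ Q.stab, ∃ R₂ ∈ Q.stab,
      supp (R₁ : Op n) ⊆ {i, j} ∧ supp (R₂ : Op n) ⊆ {i, j}ᶜ ∧ R = R₁ * R₂

def FreeOfBellPairs : Prop := ¬ Q.HasBellPair

/-- Every qubit is in the support of some stabilizer element. -/
def FreeOfTriviallyEncodedQubits : Prop := ∀ j : Fin n, ∃ R ∈ Q.stab, j ∈ supp (R : Op n)

/-- A choice of `k` logical qubits of the code `Q`, where `|S| = 2^(n-k)`: logical Pauli operators
`X̄_i, Z̄_i`, Pauli operators in the centralizer of the stabilizer that square to the identity and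
satisfy the commutation relations of the `k`-qubit Pauli operators `X_i, Z_i`. -/
structure LogicalBasis (k : ℕ) where
  card_mul : Nat.card Q.stab * 2 ^ k = 2 ^ n
  X : Fin k → Op n
  Z : Fin k → Op n
  X_isPauli : ∀ i, IsPauli (X i)
  Z_isPauli : ∀ i, IsPauli (Z i)
  X_centralizes : ∀ i, ∀ R ∈ Q.stab, X i * (R : Op n) = R * X i
  Z_centralizes : ∀ i, ∀ R ∈ Q.stab, Z i * (R : Op n) = R * Z i
  X_sq : ∀ i, X i * X i = 1
  Z_sq : ∀ i, Z i * Z i = 1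
  X_comm : ∀ i j, X i * X j = X j * X i
  Z_comm : ∀ i j, Z i * Z j = Z j * Z i
  XZ_comm : ∀ i j, i ≠ j → X i * Z j = Z j * X i
  XZ_anticomm : ∀ i, X i * Z i = -(Z i * X i)

variable {Q}

/-- The one-qubit operator `u` acting on the `s`-th logical qubit. Expanding
`u = c₀ I + c₁ X + c₂ X Z + c₃ Z`, this is `c₀ I + c₁ X̄_s + c₂ X̄_s Z̄_s + c₃ Z̄_s`, which acts on
the code space as `u` on the logical qubit `s` and as the identity on the other logical qubits. -/
def LogicalBasis.encode {k : ℕ} (L : Q.LogicalBasis k) (s : Fin k)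
    (u : Matrix (Fin 2) (Fin 2) ℂ) : Op n :=
  ((u 0 0 + u 1 1) / 2) • (1 : Op n) + ((u 0 1 + u 1 0) / 2) • L.X s
    + ((u 1 0 - u 0 1) / 2) • (L.X s * L.Z s) + ((u 0 0 - u 1 1) / 2) • L.Z s

/-- `u` acting on the `s`-th logical qubit of block `b` out of `N` blocks, and as the identity on
all the other logical qubits and blocks. -/
def LogicalBasis.encodeBlock {k : ℕ} (L : Q.LogicalBasis k) (s : Fin k) {N : ℕ} (b : Fin N)
    (u : Matrix (Fin 2) (Fin 2) ℂ) : BlockOp N n :=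
  kron (Function.update (fun _ : Fin N => (1 : Op n)) b (L.encode s u))

variable (Q)

/-- The logical gates on `Q^{⊗ r}`: special unitaries that commute with the code projector. -/
def logicalGates (r : ℕ) : Set (BlockOp r n) :=
  {U | U ∈ Matrix.specialUnitaryGroup (Fin r → Fin n → Fin 2) ℂ ∧
    U * Q.blockProj r = Q.blockProj r * U}

/-- `Trans(Q^{⊗ r})`, the transversal gates: logical gates on `Q^{⊗ r}` of the form `⨂ j, u j`, where
`u j ∈ SU(2^r)` acts on the `j`-th qubit of each block. -/
def transversalGates (r : ℕ) : Set (BlockOp r n) :=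
  {U | U ∈ Q.logicalGates r ∧
    ∃ u : Fin n → Op r, (∀ j, u j ∈ Matrix.specialUnitaryGroup (Fin r → Fin 2) ℂ) ∧
      U = transversal u}

variable {Q}

/-- The set `A` of `r`-block gates is encoded universal for the `s`-th logical qubit of block `b`,
on `N` blocks: every one-qubit gate `u` on that logical qubit can be approximated on the code space
to any accuracy `ε` in operator norm, up to a global phase `c`, by a product of gates from `A`, each
applied to some `r` of the `N` blocks. -/
def LogicalBasis.EncodedUniversal {k : ℕ} (L : Q.LogicalBasis k) (s : Fin k) {r : ℕ}
    (A : Set (BlockOp r n)) {N : ℕ} (b : Fin N) : Prop :=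
  ∀ u ∈ Matrix.specialUnitaryGroup (Fin 2) ℂ, ∀ ε : ℝ, 0 < ε →
    ∃ (l : List (BlockOp N n)) (c : ℂ),
      (∀ V ∈ l, ∃ (e : Fin r ↪ Fin N) (U : BlockOp r n), U ∈ A ∧ V = place e U) ∧ ‖c‖ = 1 ∧
      ‖L.encodeBlock s b u * Q.blockProj N - (c • l.prod) * Q.blockProj N‖ < ε

end StabilizerCode

end

/-! The argument has the shape of the Eastin–Knill theorem: transversal gates near the identity act
commutatively on the code, whereas rotations about `X̄_s` and `Z̄_s` do not commute. The local input
is `commute_proj_mul_site_mul_proj`: the compressions `P a P` of one-qubit operators to the code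
commute with one another. For qubit `j`, either two different non-identity Paulis occur there in the
stabilizer, and then `P a P` is a multiple of `P`; or only one Pauli `q` occurs, and then `a` may be
replaced by an operator in the span of `1` and `q`, which preserves the code. By multilinearity the
same holds for `N` blocks, with arbitrary operators on the `N` copies of a qubit. A transversal gate
near the identity is the exponential of a small sum `H` of such operators. If it preserves the code,
then so does `H`, so two such gates commute on the code (`exists_nhds_one_commute`). The
code-preserving tensor products of unitaries on `N` blocks form a compact group containing every
circuit of placed gates. Hence approximation up to phase becomes exact equality up to phase
(`exists_eq`). A transversal gate that realizes a small rotation need not itself be near the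
identity, but a quotient of two terms of a convergent sequence of such gates is. So some non-trivial
rotation about each of `X̄_s` and `Z̄_s` is realized near the identity
(`exists_rotation_eq_transversal_mem_nhds`). These two rotations would commute on the code, which
forces `P = 0`. -/

noncomputable section

open Filter Topology Kronecker

namespace StabCode

/-! ### Tensor products and operators on one factor -/

section Kron

variable {ι α : Type*} [Fintype ι]

theorem kron_apply (A : ι → Matrix α α ℂ) (x y : ι → α) : kron A x y = ∏ i, A i (x i) (y i) := rfl

theorem kron_mul [DecidableEq ι] [Fintype α] (A B : ι → Matrix α α ℂ) :
    kron A * kron B = kron (A * B) := by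
  ext x y
  simp only [Matrix.mul_apply, kron_apply, Pi.mul_apply, Fintype.prod_sum, Finset.prod_mul_distrib]

theorem kron_one [DecidableEq α] : kron (1 : ι → Matrix α α ℂ) = 1 := by
  classical
  ext x y
  simp [kron_apply, Matrix.one_apply, Fintype.prod_ite_zero, funext_iff]

theorem trace_kron [DecidableEq ι] [Fintype α] (A : ι → Matrix α α ℂ) :
    (kron A).trace = ∏ i, (A i).trace := by
  simp only [Matrix.trace, Matrix.diag_apply, kron_apply, Fintype.prod_sum]

theorem kron_update_apply [DecidableEq ι] (A : ι → Matrix α α ℂ) (i : ι) (a : Matrix α α ℂ)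
    (x y : ι → α) : kron (Function.update A i a) x y =
      a (x i) (y i) * ∏ k ∈ Finset.univ.erase i, A k (x k) (y k) := by
  rw [kron_apply, ← Finset.mul_prod_erase _ _ (Finset.mem_univ i)]
  congr 1
  · simp
  · refine Finset.prod_congr rfl fun k hk => ?_
    rw [Function.update_of_ne (Finset.ne_of_mem_erase hk)]

variable [DecidableEq ι] [Fintype α] [DecidableEq α]

/-- The operator `a` acting on the tensor factor `i`. -/
def site (i : ι) : Matrix α α ℂ →ₐ[ℂ] Matrix (ι → α) (ι → α) ℂ :=
  AlgHom.ofLinearMap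
    { toFun := fun a => kron (Function.update 1 i a)
      map_add' := fun a b => by
        ext x y
        simp only [kron_update_apply, Matrix.add_apply, add_mul]
      map_smul' := fun c a => by
        ext x y
        simp only [kron_update_apply, Matrix.smul_apply, smul_eq_mul, mul_assoc, RingHom.id_apply] }
    (by
      change kron (Function.update 1 i 1) = 1
      rw [Function.update_eq_self_iff.2 (by rfl), kron_one])
    (fun a b => by
      change kron _ = kron _ * kron _
      rw [kron_mul, ← Function.update_mul, one_mul])

theorem site_apply (i : ι) (a : Matrix α α ℂ) : site i a = kron (Function.update 1 i a) := rfl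

theorem commute_site_site {i j : ι} (h : i ≠ j) (a b : Matrix α α ℂ) :
    Commute (site i a) (site j b) := by
  rw [commute_iff_eq, site_apply, site_apply, kron_mul, kron_mul]
  congr 1
  ext k : 1
  by_cases hi : k = i
  · subst hi; simp [Function.update_of_ne h]
  · simp [Function.update_of_ne hi]

theorem kron_mul_site (A : ι → Matrix α α ℂ) (i : ι) (a : Matrix α α ℂ) :
    kron A * site i a = kron (Function.update A i (A i * a)) := by
  rw [site_apply, kron_mul]
  congr 1
  ext k : 1
  by_cases hi : k = i
  · subst hi; simp
  · simp [Function.update_of_ne hi]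

theorem site_mul_kron (A : ι → Matrix α α ℂ) (i : ι) (a : Matrix α α ℂ) :
    site i a * kron A = kron (Function.update A i (a * A i)) := by
  rw [site_apply, kron_mul]
  congr 1
  ext k : 1
  by_cases hi : k = i
  · subst hi; simp
  · simp [Function.update_of_ne hi]

theorem exp_site (i : ι) (a : Matrix α α ℂ) :
    NormedSpace.exp (site i a) = site i (NormedSpace.exp a) :=
  letI : NormedAlgebra ℚ (Matrix α α ℂ) := .restrictScalars ℚ ℂ _
  (NormedSpace.map_exp (site i)
    (LinearMap.continuous_of_finiteDimensional (site (ι := ι) i).toLinearMap) a).symm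

/-- Operators on distinct factors commute, so the exponential of the sum splits into a product. This
provides logarithms of transversal operators that are sums of one-factor operators. -/
theorem exp_sum_site (h : ι → Matrix α α ℂ) :
    NormedSpace.exp (∑ i, site i (h i)) = kron fun i => NormedSpace.exp (h i) := by
  let : NormedAlgebra ℚ (Matrix (ι → α) (ι → α) ℂ) := .restrictScalars ℚ ℂ _
  have key : ∀ s : Finset ι, NormedSpace.exp (∑ i ∈ s, site i (h i)) =
      kron fun i => if i ∈ s then NormedSpace.exp (h i) else 1 := by
    intro s
    induction s using Finset.induction_on with
    | empty =>
      simp only [Finset.sum_empty, NormedSpace.exp_zero, Finset.notMem_empty, if_false]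
      exact kron_one.symm
    | insert j s hj ih =>
      rw [Finset.sum_insert hj, NormedSpace.exp_add_of_commute, ih, exp_site, site_mul_kron]
      · congr 1
        ext k : 1
        by_cases hk : k = j
        · subst hk; simp [hj]
        · simp [hk]
      · exact Commute.sum_right _ _ _ fun i hi =>
          commute_site_site (ne_of_mem_of_not_mem hi hj).symm _ _
  simpa using key Finset.univ

/-- Products of one-factor operators span all operators. -/
theorem span_range_kron :
    Submodule.span ℂ (Set.range (kron : (ι → Matrix α α ℂ) → _)) = ⊤ := by
  rw [eq_top_iff]
  rintro A -
  rw [Matrix.matrix_eq_sum_single A]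
  refine Submodule.sum_mem _ fun x _ => Submodule.sum_mem _ fun y _ => ?_
  have : Matrix.single x y (A x y) = A x y • kron fun i => Matrix.single (x i) (y i) (1 : ℂ) := by
    ext x' y'
    simp [kron_apply, Matrix.single_apply, Fintype.prod_ite_zero, funext_iff, forall_and]
  rw [this]
  exact Submodule.smul_mem _ _ (Submodule.subset_span ⟨_, rfl⟩)

end Kron

/-! ### Exponentials and an invariant idempotent -/

section Exp

/-- The exponentials of two elements that commute with an idempotent `p` commute on the range
of `p` if the elements do. -/
theorem commute_exp_mul_of_commute {𝔸 : Type*} [NormedRing 𝔸] {p a b : 𝔸}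
    (hp : p * p = p) (ha : Commute a p)
    (hb : Commute b p) (hab : Commute (p * a * p) (p * b * p)) :
    Commute (NormedSpace.exp a * p) (NormedSpace.exp b * p) := by
  -- Commuting on the range of `p` means that `a * p` commutes with `b`, hence with `exp b`.
  -- Applying this twice exponentiates one element at a time.
  have key : ∀ {a b : 𝔸}, Commute a p → Commute b p → a * b * p = b * a * p →
      a * NormedSpace.exp b * p = NormedSpace.exp b * a * p := by
    intro a b ha hb h
    have h1 : Commute (a * p) b := by
      rw [commute_iff_eq, mul_assoc, ← hb.eq, ← mul_assoc, h, mul_assoc]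
    have h2 := h1.exp_right.eq
    rwa [mul_assoc, ← hb.exp_left.eq, ← mul_assoc, ← mul_assoc] at h2
  have e : ∀ {a b : 𝔸}, Commute a p → Commute b p → a * p * (b * p) = a * b * p := by
    intro a b _ hb
    rw [mul_assoc, ← mul_assoc p, ← hb.eq, mul_assoc b, hp, mul_assoc]
  have e' : ∀ {a : 𝔸}, Commute a p → p * a * p = a * p := by
    intro a ha
    rw [← ha.eq, mul_assoc, hp]
  rw [e' ha, e' hb, commute_iff_eq, e ha hb, e hb ha] at hab
  rw [commute_iff_eq, e ha.exp_left hb.exp_left, e hb.exp_left ha.exp_left]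
  exact (key hb.exp_left ha (key ha hb hab).symm).symm

variable {𝔸 : Type*} [NormedRing 𝔸] [NormedAlgebra ℂ 𝔸] [CompleteSpace 𝔸]

/-- The derivative at `0` is the identity, so the inverse function theorem applies; it also gives
the local injectivity below. -/
theorem map_exp_nhds_zero : map (NormedSpace.exp : 𝔸 → 𝔸) (𝓝 0) = 𝓝 1 := by
  have h : HasStrictFDerivAt (NormedSpace.exp : 𝔸 → 𝔸)
      ((ContinuousLinearEquiv.refl ℂ 𝔸 : 𝔸 ≃L[ℂ] 𝔸) : 𝔸 →L[ℂ] 𝔸) 0 :=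
    hasStrictFDerivAt_exp_zero
  rw [h.map_nhds_eq_of_equiv, NormedSpace.exp_zero]

theorem exists_nhds_zero_injOn_exp :
    ∃ s ∈ 𝓝 (0 : 𝔸), Set.InjOn (NormedSpace.exp : 𝔸 → 𝔸) s := by
  have h : HasStrictFDerivAt (NormedSpace.exp : 𝔸 → 𝔸)
      ((ContinuousLinearEquiv.refl ℂ 𝔸 : 𝔸 ≃L[ℂ] 𝔸) : 𝔸 →L[ℂ] 𝔸) 0 :=
    hasStrictFDerivAt_exp_zero
  exact ⟨_, (h.toOpenPartialHomeomorph _).open_source.mem_nhds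
    h.mem_toOpenPartialHomeomorph_source, (h.toOpenPartialHomeomorph _).injOn⟩

/-- Near `0`, an element commutes with an idempotent as soon as its exponential does. -/
theorem eventually_commute_of_commute_exp {p : 𝔸} (hp : p * p = p) :
    ∀ᶠ a in 𝓝 (0 : 𝔸), Commute (NormedSpace.exp a) p → Commute a p := by
  let : NormedAlgebra ℚ 𝔸 := .restrictScalars ℚ ℂ 𝔸
  obtain ⟨s, hs, hinj⟩ := exists_nhds_zero_injOn_exp (𝔸 := 𝔸)
  -- The reflection `1 - 2p` is an involution with the same commutant as `p`. Conjugating `a` by it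
  -- gives another small element with the same exponential, which local injectivity identifies with
  -- `a`.
  set q : 𝔸 := 1 - p - p with hq
  have hqq : q * q = 1 := by
    simp only [hq, sub_mul, mul_sub, one_mul, mul_one, hp]; abel
  let u : 𝔸ˣ := ⟨q, q, hqq, hqq⟩
  have hc : Tendsto (fun a : 𝔸 => q * a * q) (𝓝 0) (𝓝 0) := by
    have : Continuous fun a : 𝔸 => q * a * q := by fun_prop
    simpa using this.tendsto 0
  filter_upwards [hs, hc hs] with a ha ha' hcomm
  have h1 : Commute (NormedSpace.exp a) q :=
    ((Commute.one_right _).sub_right hcomm).sub_right hcomm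
  have h2 : NormedSpace.exp (q * a * q) = NormedSpace.exp a := by
    have := NormedSpace.exp_units_conj u a
    change NormedSpace.exp (q * a * q) = q * NormedSpace.exp a * q at this
    rw [this, ← h1.eq, mul_assoc, hqq, mul_one]
  have h3 : q * a * q = a := hinj ha' ha h2
  have h4 : q * a = a * q := by
    conv_rhs => rw [← h3]
    rw [mul_assoc (q * a), hqq, mul_one]
  have h5 : (2 : ℂ) • (a * p) = (2 : ℂ) • (p * a) := by
    simp only [hq, sub_mul, mul_sub, one_mul, mul_one] at h4
    rw [two_smul, two_smul]
    have h6 : a - (p * a + p * a) = a - (a * p + a * p) := by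
      rw [← sub_sub, ← sub_sub]; exact h4
    exact (sub_right_injective h6).symm
  exact smul_right_injective _ (two_ne_zero) h5

end Exp

/-! ### Operators on some of the tensor factors -/

section Expand

variable {ι κ α : Type*}

open Classical in
/-- Splitting of a family indexed by `κ` into its restrictions along `e` and to the complement of
the range of `e`. -/
def splitEquiv (e : ι ↪ κ) : (κ → α) ≃ (ι → α) × ({b // b ∉ Set.range e} → α) where
  toFun x := (fun i => x (e i), fun b => x b)
  invFun p b := if h : b ∈ Set.range e then p.1 h.choose else p.2 ⟨b, h⟩
  left_inv x := by
    ext b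
    by_cases h : b ∈ Set.range e
    · simp only [h, dif_pos]; rw [h.choose_spec]
    · simp only [h, dif_neg, not_false_eq_true]
  right_inv p := by
    ext b
    · have h : e b ∈ Set.range e := ⟨b, rfl⟩
      simp only [h, dif_pos]
      rw [e.injective h.choose_spec]
    · simp only [b.2, dif_neg, not_false_eq_true]

open Classical in
/-- The operator `A` acting on the tensor factors in the range of `e`. -/
def expand (e : ι ↪ κ) (A : Matrix (ι → α) (ι → α) ℂ) : Matrix (κ → α) (κ → α) ℂ :=
  (A ⊗ₖ (1 : Matrix ({b // b ∉ Set.range e} → α) ({b // b ∉ Set.range e} → α) ℂ)).submatrix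
    (splitEquiv e) (splitEquiv e)

theorem expand_eq (e : ι ↪ κ) [DecidableEq ({b // b ∉ Set.range e} → α)]
    (A : Matrix (ι → α) (ι → α) ℂ) : expand e A =
      (A ⊗ₖ (1 : Matrix ({b // b ∉ Set.range e} → α) ({b // b ∉ Set.range e} → α) ℂ)).submatrix
        (splitEquiv e) (splitEquiv e) := by
  rw [expand]
  congr!

open Classical in
theorem expand_apply (e : ι ↪ κ) (A : Matrix (ι → α) (ι → α) ℂ) (x y : κ → α) :
    expand e A x y = if ∀ b, b ∉ Set.range e → x b = y b then
      A (fun i => x (e i)) (fun i => y (e i)) else 0 := by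
  simp only [expand, splitEquiv, Matrix.submatrix_apply, Equiv.coe_fn_mk, Matrix.kroneckerMap_apply,
    Matrix.one_apply, funext_iff, Subtype.forall, mul_ite, mul_one, mul_zero]

theorem expand_conjTranspose (e : ι ↪ κ) (A : Matrix (ι → α) (ι → α) ℂ) :
    (expand e A).conjTranspose = expand e A.conjTranspose := by
  classical
  rw [expand, Matrix.conjTranspose_submatrix, Matrix.conjTranspose_kronecker,
    Matrix.conjTranspose_one, expand]

theorem expand_one [DecidableEq (ι → α)] [DecidableEq (κ → α)] (e : ι ↪ κ) :
    expand e (1 : Matrix (ι → α) (ι → α) ℂ) = 1 := by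
  classical
  rw [expand_eq, Matrix.one_kronecker_one, Matrix.submatrix_one_equiv]

variable [Fintype ι] [Fintype κ]

theorem expand_mul [Fintype (ι → α)] [Fintype (κ → α)] (e : ι ↪ κ)
    [Fintype ({b // b ∉ Set.range e} → α)]
    (A B : Matrix (ι → α) (ι → α) ℂ) :
    expand e A * expand e B = expand e (A * B) := by
  classical
  rw [expand_eq, expand_eq, Matrix.submatrix_mul_equiv, ← Matrix.mul_kronecker_mul, mul_one,
    expand_eq]

theorem expand_mem_unitaryGroup [Fintype α] [DecidableEq ι] [DecidableEq κ] [DecidableEq α]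
    (e : ι ↪ κ) {A : Matrix (ι → α) (ι → α) ℂ} (hA : A ∈ Matrix.unitaryGroup (ι → α) ℂ) :
    expand e A ∈ Matrix.unitaryGroup (κ → α) ℂ := by
  classical
  rw [Matrix.mem_unitaryGroup_iff] at hA ⊢
  rw [Matrix.star_eq_conjTranspose] at hA ⊢
  rw [expand_conjTranspose, expand_mul, hA, expand_one]

theorem kron_const_eq_submatrix (e : ι ↪ κ) (p : Matrix α α ℂ) [DecidablePred (· ∈ Set.range e)] :
    kron (fun _ : κ => p) = (kron (fun _ : ι => p) ⊗ₖ
      kron (fun _ : {b // b ∉ Set.range e} => p)).submatrix (splitEquiv e) (splitEquiv e) := by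
  ext x y
  simp only [kron_apply, splitEquiv, Matrix.submatrix_apply, Equiv.coe_fn_mk,
    Matrix.kroneckerMap_apply]
  rw [← Fintype.prod_subtype_mul_prod_subtype (· ∈ Set.range e)]
  congr 1
  exact (Fintype.prod_equiv (Equiv.ofInjective e e.injective) _ _ fun i => rfl).symm

theorem commute_expand_kron_const [DecidableEq ι] [DecidableEq κ] [Fintype α]
    (e : ι ↪ κ) {A : Matrix (ι → α) (ι → α) ℂ} {p : Matrix α α ℂ}
    (h : Commute A (kron fun _ => p)) : Commute (expand e A) (kron fun _ => p) := by
  classical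
  rw [commute_iff_eq, kron_const_eq_submatrix e, expand_eq, Matrix.submatrix_mul_equiv,
    Matrix.submatrix_mul_equiv, ← Matrix.mul_kronecker_mul, ← Matrix.mul_kronecker_mul, h.eq,
    mul_one, one_mul]

end Expand

/-! ### Pauli matrices and twirling -/

section Pauli

theorem pauli_zero : pauli 0 = 1 := rfl

theorem pauli_mul_self (q : Fin 4) : pauli q * pauli q = 1 := by
  fin_cases q <;> ext i j <;> fin_cases i <;> fin_cases j <;>
    simp [pauli, Matrix.mul_apply, Fin.sum_univ_two]

theorem trace_pauli {q : Fin 4} (hq : q ≠ 0) : (pauli q).trace = 0 := by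
  fin_cases q <;> simp [pauli, Matrix.trace, Fin.sum_univ_two] at hq ⊢

theorem pauli_conj_pauli {q q' : Fin 4} (hq : q ≠ 0) (hq' : q' ≠ 0) (h : q' ≠ q) :
    pauli q' * pauli q * pauli q' = -pauli q := by
  fin_cases q <;> fin_cases q' <;> first
    | exact absurd rfl hq
    | exact absurd rfl hq'
    | exact absurd rfl h
    | (ext i j; fin_cases i <;> fin_cases j <;>
        simp [pauli, Matrix.mul_apply, Fin.sum_univ_two])

/-- In the Pauli basis, the twirl by `q` cancels the two components that anticommute with `q` and
doubles those along `1` and `q`. -/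
theorem add_pauli_conj {q : Fin 4} (hq : q ≠ 0) (a : Matrix (Fin 2) (Fin 2) ℂ) :
    a + pauli q * a * pauli q = a.trace • (1 : Matrix (Fin 2) (Fin 2) ℂ) +
      (pauli q * a).trace • pauli q := by
  obtain ⟨w, x, y, z, rfl⟩ : ∃ w x y z, a = !![w, x; y, z] := ⟨_, _, _, _, a.eta_fin_two⟩
  fin_cases q <;> first
    | exact absurd rfl hq
    | (ext i j; fin_cases i <;> fin_cases j <;>
        simp [pauli, Matrix.trace_fin_two_of] <;> (try ring_nf) <;>
        (try simp only [Complex.I_sq]) <;> (try ring_nf))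

theorem two_smul_eq_of_commute_pauli {q : Fin 4} (hq : q ≠ 0) {a : Matrix (Fin 2) (Fin 2) ℂ}
    (h : Commute a (pauli q)) :
    (2 : ℂ) • a = a.trace • (1 : Matrix (Fin 2) (Fin 2) ℂ) + (pauli q * a).trace • pauli q := by
  rw [← add_pauli_conj hq, ← h.eq, mul_assoc, pauli_mul_self, mul_one, two_smul]

/-- The commutant of a non-identity Pauli matrix is the span of `1` and that matrix, which is
abelian. -/
theorem commute_of_commute_pauli {q : Fin 4} (hq : q ≠ 0) {a b : Matrix (Fin 2) (Fin 2) ℂ}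
    (ha : Commute a (pauli q)) (hb : Commute b (pauli q)) : Commute a b := by
  have h : Commute ((2 : ℂ) • a) b := by
    rw [two_smul_eq_of_commute_pauli hq ha]
    exact ((Commute.one_left b).smul_left _).add_left (hb.symm.smul_left _)
  simpa using h.smul_left (2 : ℂ)⁻¹

variable {n : ℕ}

theorem IsPauliForm.mul_site {M : Op n} {c : ℂ} {q : Fin n → Fin 4} (h : IsPauliForm M c q)
    (j : Fin n) (a : Matrix (Fin 2) (Fin 2) ℂ) :
    M * site j a = site j (pauli (q j) * a * pauli (q j)) * M := by
  rw [h.2, smul_mul_assoc, mul_smul_comm, kron_mul_site, site_mul_kron, mul_assoc, pauli_mul_self,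
    mul_one]

end Pauli

end StabCode

/-! ### Compressions of one-qubit operators to the code -/

namespace StabilizerCode

open StabCode

variable {n : ℕ} (Q : StabilizerCode n)

theorem proj_mul (T : Matrix.unitaryGroup (Fin n → Fin 2) ℂ) (hT : T ∈ Q.stab) :
    Q.proj * (T : Op n) = Q.proj := by
  rw [proj, Matrix.smul_mul, Finset.sum_mul]
  congr 1
  exact Fintype.sum_equiv (Equiv.mulRight (⟨T, hT⟩ : Q.stab)) _ _ fun _ => rfl

theorem card_stab_ne_zero : (Fintype.card Q.stab : ℂ) ≠ 0 :=
  Nat.cast_ne_zero.2 Fintype.card_ne_zero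

theorem proj_mul_proj : Q.proj * Q.proj = Q.proj := by
  nth_rewrite 1 [proj]
  rw [Matrix.smul_mul, Finset.sum_mul, Finset.sum_congr rfl fun (R : Q.stab) _ => Q.mul_proj R R.2,
    Finset.sum_const, Finset.card_univ, ← Nat.cast_smul_eq_nsmul ℂ, smul_smul, inv_mul_cancel₀ Q.card_stab_ne_zero,
    one_smul]

theorem commute_proj {A : Op n} (h : ∀ R ∈ Q.stab, A * (R : Op n) = R * A) :
    Commute A Q.proj := by
  rw [commute_iff_eq, proj, mul_smul_comm, smul_mul_assoc, Finset.mul_sum, Finset.sum_mul]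
  congr 1
  exact Finset.sum_congr rfl fun (R : Q.stab) _ => h R R.2

/-- A non-identity tensor factor has trace zero. Otherwise `R` is a phase, and `-1`, `i`, `-i` are
excluded because `R` or `R * R` would be `-I`. -/
theorem trace_eq_zero_of_mem {R : Matrix.unitaryGroup (Fin n → Fin 2) ℂ} (hR : R ∈ Q.stab)
    (h1 : R ≠ 1) : (R : Op n).trace = 0 := by
  obtain ⟨c, q, hc, hq⟩ := Q.isPauli R hR
  by_cases h : ∃ j, q j ≠ 0
  · obtain ⟨j, hj⟩ := h
    rw [hq, Matrix.trace_smul, trace_kron,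
      Finset.prod_eq_zero (Finset.mem_univ j) (trace_pauli hj), smul_zero]
  · push Not at h
    have hR1 : (R : Op n) = c • 1 := by
      rw [hq, ← kron_one]
      congr 2
      ext j : 1
      rw [h j]; rfl
    have hsq : ((R * R : Matrix.unitaryGroup (Fin n → Fin 2) ℂ) : Op n) = (c * c) • 1 := by
      rw [Submonoid.coe_mul, hR1, smul_mul_smul_comm, one_mul]
    rcases hc with rfl | rfl | rfl | rfl
    · exact absurd (Subtype.ext (by simpa using hR1)) h1
    · exact absurd (by simpa using hR1) (Q.neg_one_notMem R hR)
    · exact absurd (by simpa using hsq) (Q.neg_one_notMem _ (Q.stab.mul_mem hR hR))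
    · exact absurd (by simpa using hsq) (Q.neg_one_notMem _ (Q.stab.mul_mem hR hR))

theorem proj_ne_zero : Q.proj ≠ 0 := by
  intro h
  have ht : Q.proj.trace = (Fintype.card Q.stab : ℂ)⁻¹ * 2 ^ n := by
    rw [proj, Matrix.trace_smul, Matrix.trace_sum, Finset.sum_eq_single (1 : Q.stab)]
    · simp [Matrix.trace_one]
    · intro R _ hR
      exact Q.trace_eq_zero_of_mem R.2 fun e => hR (Subtype.ext e)
    · simp
  rw [h, Matrix.trace_zero] at ht
  exact mul_ne_zero (inv_ne_zero Q.card_stab_ne_zero) (pow_ne_zero _ two_ne_zero) ht.symm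

/-- The projector absorbs `R` on either side, and moving `R` past a one-qubit operator conjugates it
by the factor of `R` at that qubit. -/
theorem proj_mul_site_conj_mul_proj {R : Matrix.unitaryGroup (Fin n → Fin 2) ℂ} (hR : R ∈ Q.stab)
    {c : ℂ} {q : Fin n → Fin 4} (h : IsPauliForm (R : Op n) c q) (j : Fin n)
    (a : Matrix (Fin 2) (Fin 2) ℂ) :
    Q.proj * site j (pauli (q j) * a * pauli (q j)) * Q.proj = Q.proj * site j a * Q.proj := by
  calc _ = Q.proj * site j (pauli (q j) * a * pauli (q j)) * ((R : Op n) * Q.proj) := by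
        rw [Q.mul_proj R hR]
    _ = Q.proj * ((R : Op n) * site j a) * Q.proj := by
        rw [h.mul_site]; simp only [mul_assoc]
    _ = _ := by rw [← mul_assoc, Q.proj_mul R hR]

theorem proj_mul_site_add_conj_mul_proj {R : Matrix.unitaryGroup (Fin n → Fin 2) ℂ}
    (hR : R ∈ Q.stab) {c : ℂ} {q : Fin n → Fin 4} (h : IsPauliForm (R : Op n) c q) (j : Fin n)
    (a : Matrix (Fin 2) (Fin 2) ℂ) :
    Q.proj * site j ((2 : ℂ)⁻¹ • (a + pauli (q j) * a * pauli (q j))) * Q.proj =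
      Q.proj * site j a * Q.proj := by
  rw [map_smul, map_add, mul_smul_comm, smul_mul_assoc, mul_add, add_mul,
    Q.proj_mul_site_conj_mul_proj hR h, ← two_smul ℂ, smul_smul, inv_mul_cancel₀ two_ne_zero,
    one_smul]

/-- On the code space, all operators on a non-trivially encoded qubit act as operators which
preserve the code space and commute with a fixed Pauli matrix. -/
theorem exists_pauli_forall_proj_mul_site (hTriv : Q.FreeOfTriviallyEncodedQubits) (j : Fin n) :
    ∃ q : Fin 4, q ≠ 0 ∧ ∀ a, ∃ a', Q.proj * site j a * Q.proj = Q.proj * site j a' * Q.proj ∧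
      Commute a' (pauli q) ∧ Commute (site j a') Q.proj := by
  obtain ⟨R, hR, c, q, hRq, hq⟩ := hTriv j
  refine ⟨q j, hq, fun a => ?_⟩
  set a₁ := (2 : ℂ)⁻¹ • (a + pauli (q j) * a * pauli (q j)) with ha₁
  have e₁ : Q.proj * site j a₁ * Q.proj = Q.proj * site j a * Q.proj :=
    Q.proj_mul_site_add_conj_mul_proj hR hRq j a
  have h₁ : a₁ = (2 : ℂ)⁻¹ • (a.trace • (1 : Matrix (Fin 2) (Fin 2) ℂ) +
      (pauli (q j) * a).trace • pauli (q j)) := by rw [ha₁, add_pauli_conj hq]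
  -- The first twirl leaves `a₁` in the span of `1` and `q j`. If a second Pauli occurs at `j`,
  -- twirling by it leaves a scalar. If not, every stabilizer element has `1` or `q j` at `j`, so it
  -- already commutes with `a₁`.
  by_cases hS : ∃ T ∈ Q.stab, ∃ c' q', IsPauliForm (T : Op n) c' q' ∧ q' j ≠ 0 ∧ q' j ≠ q j
  · obtain ⟨T, hT, c', q', hTq, h0, h1⟩ := hS
    refine ⟨(2 : ℂ)⁻¹ • (a₁ + pauli (q' j) * a₁ * pauli (q' j)), ?_, ?_⟩
    · rw [Q.proj_mul_site_add_conj_mul_proj hT hTq, e₁]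
    · have : (2 : ℂ)⁻¹ • (a₁ + pauli (q' j) * a₁ * pauli (q' j)) =
          ((2 : ℂ)⁻¹ * a.trace) • (1 : Matrix (Fin 2) (Fin 2) ℂ) := by
        rw [h₁]
        simp only [mul_add, add_mul, mul_smul_comm, smul_mul_assoc, mul_one, pauli_mul_self,
          pauli_conj_pauli hq h0 h1, smul_add, smul_neg, smul_smul]
        module
      rw [this, map_smul, map_one]
      exact ⟨(Commute.one_left _).smul_left _, (Commute.one_left _).smul_left _⟩
  · push Not at hS
    have hc : Commute a₁ (pauli (q j)) := by
      rw [h₁]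
      exact (((Commute.one_left _).smul_left _).add_left ((Commute.refl _).smul_left _)).smul_left _
    refine ⟨a₁, e₁.symm, hc, Q.commute_proj fun T hT => ?_⟩
    obtain ⟨c', q', hTq⟩ := Q.isPauli T hT
    rw [hTq.mul_site]
    congr 2
    by_cases h0 : q' j = 0
    · rw [h0, pauli_zero, one_mul, mul_one]
    · rw [hS T hT c' q' hTq h0, ← hc.eq, mul_assoc, pauli_mul_self, mul_one]

/-- Both operators can be replaced by ones that preserve the code. On different qubits these commute
outright; on the same qubit both lie in the abelian commutant of one Pauli matrix. -/
theorem commute_proj_mul_site_mul_proj (hTriv : Q.FreeOfTriviallyEncodedQubits) (i j : Fin n)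
    (a b : Matrix (Fin 2) (Fin 2) ℂ) :
    Commute (Q.proj * site i a * Q.proj) (Q.proj * site j b * Q.proj) := by
  obtain ⟨q, hq, ha⟩ := Q.exists_pauli_forall_proj_mul_site hTriv i
  obtain ⟨q', -, hb⟩ := Q.exists_pauli_forall_proj_mul_site hTriv j
  obtain ⟨a', ha', hac, hap⟩ := ha a
  have key : ∀ b', Commute (site i a') (site j b') → Commute (site j b') Q.proj →
      Commute (Q.proj * site i a' * Q.proj) (Q.proj * site j b' * Q.proj) := by
    intro b' h hbp
    exact ((((Commute.refl _).mul_right hbp.symm).mul_right (Commute.refl _)).mul_left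
      ((hap.mul_right h).mul_right hap)).mul_left
      (((Commute.refl _).mul_right hbp.symm).mul_right (Commute.refl _))
  by_cases hij : i = j
  · subst hij
    obtain ⟨b', hb', hbc, hbp⟩ := ha b
    rw [ha', hb']
    exact key b' ((commute_of_commute_pauli hq hac hbc).map (site i)) hbp
  · obtain ⟨b', hb', hbc, hbp⟩ := hb b
    rw [ha', hb']
    exact key b' (commute_site_site hij _ _) hbp

/-! ### Transversal operators -/

/-- The identification of the operators on `n` groups of `N` qubits with those on `N` blocks. -/
def swapBlocks (n N : ℕ) :
    Matrix (Fin n → Fin N → Fin 2) (Fin n → Fin N → Fin 2) ℂ ≃ₐ[ℂ] BlockOp N n :=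
  Matrix.reindexAlgEquiv ℂ ℂ (Equiv.piComm _)

variable {N : ℕ}

theorem transversal_eq (v : Fin n → Op N) : transversal v = swapBlocks n N (kron v) := rfl

theorem transversal_mul (v w : Fin n → Op N) :
    transversal v * transversal w = transversal (v * w) := by
  rw [transversal_eq, transversal_eq, ← map_mul, kron_mul, transversal_eq]

theorem transversal_one : transversal (1 : Fin n → Op N) = 1 := by
  rw [transversal_eq, kron_one, map_one]

theorem swapBlocks_site_kron (j : Fin n) (a : Fin N → Matrix (Fin 2) (Fin 2) ℂ) :
    swapBlocks n N (site j (kron a)) = kron fun b => site j (a b) := by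
  have h : ∀ k, Function.update (1 : Fin n → Op N) j (kron a) k =
      kron fun b => Function.update (1 : Fin n → Matrix (Fin 2) (Fin 2) ℂ) j (a b) k := by
    intro k
    by_cases hk : k = j
    · subst hk; simp
    · simp only [Function.update_of_ne hk]; exact kron_one.symm
  ext x y
  change ∏ k, Function.update (1 : Fin n → Op N) j (kron a) k _ _ = _
  simp only [h, site_apply, kron_apply]
  exact Finset.prod_comm

/-- The claim is bilinear in `g` and `h`, so products of one-qubit operators suffice; for them the
compressions factor over the blocks and commute block by block. -/
theorem commute_blockProj_mul_site_mul_blockProj (hTriv : Q.FreeOfTriviallyEncodedQubits)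
    (i j : Fin n) (g h : Op N) :
    Commute (Q.blockProj N * swapBlocks n N (site i g) * Q.blockProj N)
      (Q.blockProj N * swapBlocks n N (site j h) * Q.blockProj N) := by
  have hg : g ∈ Submodule.span ℂ (Set.range (kron : (Fin N → Matrix (Fin 2) (Fin 2) ℂ) → _)) := by
    rw [span_range_kron]; trivial
  have hh : h ∈ Submodule.span ℂ (Set.range (kron : (Fin N → Matrix (Fin 2) (Fin 2) ℂ) → _)) := by
    rw [span_range_kron]; trivial
  induction hg using Submodule.span_induction with
  | zero => simp
  | add x y _ _ hx hy => simpa only [map_add, mul_add, add_mul] using hx.add_left hy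
  | smul c x _ hx => simpa only [map_smul, mul_smul_comm, smul_mul_assoc] using hx.smul_left c
  | mem x hx =>
    obtain ⟨a, rfl⟩ := hx
    induction hh using Submodule.span_induction with
    | zero => simp
    | add x y _ _ hx hy => simpa only [map_add, mul_add, add_mul] using hx.add_right hy
    | smul c x _ hx => simpa only [map_smul, mul_smul_comm, smul_mul_assoc] using hx.smul_right c
    | mem x hx =>
      obtain ⟨b, rfl⟩ := hx
      rw [swapBlocks_site_kron, swapBlocks_site_kron, blockProj, kron_mul, kron_mul, kron_mul,
        kron_mul, commute_iff_eq, kron_mul, kron_mul]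
      exact congrArg kron
        (funext fun k => (Q.commute_proj_mul_site_mul_proj hTriv i j (a k) (b k)).eq)

theorem blockProj_mul_blockProj : Q.blockProj N * Q.blockProj N = Q.blockProj N := by
  rw [blockProj, kron_mul]
  congr 1
  ext k : 1
  exact Q.proj_mul_proj

theorem blockProj_ne_zero : Q.blockProj N ≠ 0 := by
  intro h
  obtain ⟨x, y, hxy⟩ : ∃ x y, Q.proj x y ≠ 0 := by
    by_contra! hc
    exact Q.proj_ne_zero (Matrix.ext hc)
  have := congrFun (congrFun h fun _ => x) fun _ => y
  simp only [blockProj, kron_apply, Matrix.zero_apply, Finset.prod_const] at this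
  exact hxy (eq_zero_of_pow_eq_zero this)

/-- Transversal gates near the identity commute on the code space. -/
theorem exists_nhds_one_commute (hTriv : Q.FreeOfTriviallyEncodedQubits) :
    ∃ W ∈ 𝓝 (1 : Fin n → Op N), ∀ v ∈ W, ∀ w ∈ W,
      Commute (transversal v) (Q.blockProj N) → Commute (transversal w) (Q.blockProj N) →
      Commute (transversal v * Q.blockProj N) (transversal w * Q.blockProj N) := by
  set f : (Fin n → Op N) → BlockOp N n := fun h => swapBlocks n N (∑ j, site j (h j)) with hf
  have hf0 : f 0 = 0 := by simp [hf]
  have hfc : Continuous f := by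
    have h1 : Continuous (swapBlocks n N) :=
      LinearMap.continuous_of_finiteDimensional (swapBlocks n N).toLinearMap
    refine h1.comp (continuous_finsetSum _ fun j _ => ?_)
    exact (LinearMap.continuous_of_finiteDimensional
      (site (ι := Fin n) (α := Fin N → Fin 2) j).toLinearMap).comp (continuous_apply j)
  have hexp : ∀ h, transversal (NormedSpace.exp h) = NormedSpace.exp (f h) := by
    intro h
    let : NormedAlgebra ℚ (Matrix (Fin n → Fin N → Fin 2) (Fin n → Fin N → Fin 2) ℂ) :=
      .restrictScalars ℚ ℂ _
    have h1 : Continuous (swapBlocks n N) :=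
      LinearMap.continuous_of_finiteDimensional (swapBlocks n N).toLinearMap
    rw [hf, ← NormedSpace.map_exp (swapBlocks n N) h1, exp_sum_site, transversal_eq]
    congr 2
    ext j : 1
    let : ∀ j : Fin n, NormedAlgebra ℚ (Op N) := fun _ => .restrictScalars ℚ ℂ _
    exact NormedSpace.map_exp (Pi.evalRingHom (fun _ : Fin n => Op N) j) (continuous_apply j) h
  have hev := eventually_commute_of_commute_exp (𝔸 := BlockOp N n) Q.blockProj_mul_blockProj
  have hU : {h | Commute (NormedSpace.exp (f h)) (Q.blockProj N) → Commute (f h) (Q.blockProj N)} ∈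
      𝓝 (0 : Fin n → Op N) := (hf0 ▸ hfc.tendsto 0).eventually hev
  -- `W` is the set of exponentials of families `h` for which `f h` preserves the code as soon as
  -- its exponential does.
  refine ⟨_, map_exp_nhds_zero (𝔸 := Fin n → Op N) ▸ image_mem_map hU, ?_⟩
  rintro _ ⟨g, hg, rfl⟩ _ ⟨h, hh, rfl⟩ hgP hhP
  rw [hexp] at hgP hhP ⊢
  rw [hexp]
  refine commute_exp_mul_of_commute Q.blockProj_mul_blockProj (hg hgP) (hh hhP) ?_
  simp only [hf, map_sum, Finset.mul_sum, Finset.sum_mul]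
  exact Commute.sum_left _ _ _ fun i _ => Commute.sum_right _ _ _ fun j _ =>
    Q.commute_blockProj_mul_site_mul_blockProj hTriv i j _ _

end StabilizerCode

namespace StabCode

/-! ### Compactness of the unitary group -/

section Unitary

theorem isCompact_unitaryGroup {m : Type*} [Fintype m] [DecidableEq m] [Nonempty m] :
    IsCompact (Matrix.unitaryGroup m ℂ : Set (Matrix m m ℂ)) := by
  have : ProperSpace (Matrix m m ℂ) := FiniteDimensional.proper ℂ _
  refine Metric.isCompact_of_isClosed_isBounded ?_ ?_
  · have h : (Matrix.unitaryGroup m ℂ : Set (Matrix m m ℂ)) = {A | A * star A = 1} := by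
      ext A; exact Matrix.mem_unitaryGroup_iff
    rw [h]
    exact isClosed_eq (by fun_prop) continuous_const
  · refine (Metric.isBounded_closedBall (x := (0 : Matrix m m ℂ)) (r := 1)).subset fun A hA => ?_
    rw [mem_closedBall_zero_iff]
    exact (CStarRing.norm_of_mem_unitary hA).le

end Unitary

/-! ### Rotations generated by involutions -/

section Rotation

variable {𝔸 : Type*} [Ring 𝔸] [Algebra ℂ 𝔸]

/-- The rotation `exp (i t M)` generated by an involution `M`. -/
def rotation (M : 𝔸) (t : ℝ) : 𝔸 :=
  (Real.cos t : ℂ) • (1 : 𝔸) + (Complex.I * Real.sin t) • M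

theorem rotation_mul_rotation {M : 𝔸} (hM : M * M = 1) (s t : ℝ) :
    rotation M s * rotation M t = rotation M (s + t) := by
  simp only [rotation, add_mul, mul_add, smul_mul_smul_comm, mul_one, one_mul, hM, Real.cos_add,
    Real.sin_add, Complex.ofReal_sub, Complex.ofReal_add, Complex.ofReal_mul]
  have : Complex.I * (Real.sin s : ℂ) * (Complex.I * Real.sin t) = -(Real.sin s * Real.sin t) := by
    linear_combination (Real.sin s * Real.sin t : ℂ) * Complex.I_sq
  rw [this]
  module

theorem rotation_zero (M : 𝔸) : rotation M 0 = 1 := by simp [rotation]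

theorem commute_rotation {M p : 𝔸} (h : Commute M p) (t : ℝ) : Commute (rotation M t) p :=
  ((Commute.one_left _).smul_left _).add_left (h.smul_left _)

theorem map_rotation {𝔹 : Type*} [Ring 𝔹] [Algebra ℂ 𝔹] (f : 𝔸 →ₐ[ℂ] 𝔹) (M : 𝔸) (t : ℝ) :
    f (rotation M t) = rotation (f M) t := by
  simp only [rotation, map_add, map_smul, map_one]

/-- Rotations generated by anticommuting involutions do not commute. -/
theorem eq_zero_of_commute_rotation {A B p : 𝔸} (hA : A * A = 1) (hB : B * B = 1)
    (hAB : A * B = -(B * A)) (hp : p * p = p) (hAp : Commute A p) (hBp : Commute B p) {s t : ℝ}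
    (hs : Real.sin s ≠ 0) (ht : Real.sin t ≠ 0)
    (h : Commute (rotation A s * p) (rotation B t * p)) : p = 0 := by
  -- A non-zero sine allows the generator to be recovered from the rotation on the range of `p`.
  -- There `A` and `B` then both commute and anticommute, and being invertible they force `p = 0`.
  have e : ∀ {M : 𝔸} {t : ℝ}, Real.sin t ≠ 0 → M * p =
      (Complex.I * Real.sin t)⁻¹ • (rotation M t * p - (Real.cos t : ℂ) • p) := by
    intro M t ht
    have : Complex.I * (Real.sin t : ℂ) ≠ 0 :=
      mul_ne_zero Complex.I_ne_zero (Complex.ofReal_ne_zero.2 ht)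
    rw [rotation, add_mul, smul_mul_assoc, one_mul, add_sub_cancel_left, smul_mul_assoc, smul_smul,
      inv_mul_cancel₀ this, one_smul]
  have hpB : Commute p (rotation B t * p) :=
    (commute_rotation hBp t).symm.mul_right (Commute.refl p)
  have h1 : Commute (A * p) (rotation B t * p) := by
    rw [e (M := A) hs]
    exact (h.sub_left (hpB.smul_left (Real.cos s : ℂ))).smul_left (Complex.I * Real.sin s : ℂ)⁻¹
  have h2 : Commute (A * p) (B * p) := by
    rw [e (M := B) ht]
    exact (h1.sub_right ((hAp.mul_left (Commute.refl p)).smul_right (Real.cos t : ℂ))).smul_right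
      (Complex.I * Real.sin t : ℂ)⁻¹
  have h3 : A * (B * p) = B * (A * p) := by
    have := h2.eq
    rwa [mul_assoc, ← mul_assoc p, ← hBp.eq, mul_assoc B, hp, mul_assoc B, ← mul_assoc p, ← hAp.eq,
      mul_assoc A, hp] at this
  have h4 : (2 : ℂ) • (B * (A * p)) = 0 := by
    rw [two_smul]
    nth_rewrite 1 [← h3]
    rw [← mul_assoc, hAB, neg_mul, mul_assoc, neg_add_cancel]
  have h5 : B * (A * p) = 0 := (smul_eq_zero.1 h4).resolve_left two_ne_zero
  calc p = A * (B * (B * (A * p))) := by rw [← mul_assoc B, hB, one_mul, ← mul_assoc, hA, one_mul]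
    _ = 0 := by rw [h5, mul_zero, mul_zero]

theorem diag_mem_specialUnitaryGroup (t : ℝ) :
    !![(Real.cos t : ℂ) + Complex.I * Real.sin t, 0; 0, Real.cos t - Complex.I * Real.sin t] ∈
      Matrix.specialUnitaryGroup (Fin 2) ℂ := by
  have h : (Real.cos t : ℂ) ^ 2 + (Real.sin t : ℂ) ^ 2 = 1 := by
    exact_mod_cast Real.cos_sq_add_sin_sq t
  rw [Matrix.mem_specialUnitaryGroup_iff, Matrix.mem_unitaryGroup_iff]
  constructor
  · ext i j
    fin_cases i <;> fin_cases j <;>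
      simp [Matrix.mul_apply, Fin.sum_univ_two, Matrix.star_apply, -Complex.ofReal_cos,
        -Complex.ofReal_sin] <;>
      linear_combination h - (Real.sin t : ℂ) ^ 2 * Complex.I_sq
  · simp only [Matrix.det_fin_two_of]
    linear_combination h - (Real.sin t : ℂ) ^ 2 * Complex.I_sq

theorem offDiag_mem_specialUnitaryGroup (t : ℝ) :
    !![(Real.cos t : ℂ), Complex.I * Real.sin t; Complex.I * Real.sin t, Real.cos t] ∈
      Matrix.specialUnitaryGroup (Fin 2) ℂ := by
  have h : (Real.cos t : ℂ) ^ 2 + (Real.sin t : ℂ) ^ 2 = 1 := by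
    exact_mod_cast Real.cos_sq_add_sin_sq t
  rw [Matrix.mem_specialUnitaryGroup_iff, Matrix.mem_unitaryGroup_iff]
  constructor
  · ext i j
    fin_cases i <;> fin_cases j <;>
      simp [Matrix.mul_apply, Fin.sum_univ_two, Matrix.star_apply, -Complex.ofReal_cos,
        -Complex.ofReal_sin] <;> first
      | linear_combination h - (Real.sin t : ℂ) ^ 2 * Complex.I_sq
      | ring
  · simp only [Matrix.det_fin_two_of]
    linear_combination h - (Real.sin t : ℂ) ^ 2 * Complex.I_sq

end Rotation

theorem place_transversal {r N n : ℕ} (e : Fin r ↪ Fin N) (u : Fin n → Op r) :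
    place e (transversal u) = transversal fun j => expand e (u j) := by
  classical
  ext x y
  simp only [place, transversal, Matrix.of_apply, Matrix.submatrix_apply, kron_apply, expand_apply,
    Function.swap, Fintype.prod_ite_zero, funext_iff]
  congr 1
  simp only [eq_iff_iff]
  exact ⟨fun h j b hb => h b hb j, fun h b hb j => h j b hb⟩

theorem place_eq_expand {r N n : ℕ} (e : Fin r ↪ Fin N) (U : BlockOp r n) :
    place e U = expand e U := by
  ext x y
  rw [expand_apply, place, Matrix.of_apply]
  congr

end StabCode

/-! ### The compact group of code-preserving transversal operators -/

namespace StabilizerCode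

open StabCode

variable {n : ℕ} (Q : StabilizerCode n)

/-- The families of one-qubit-group unitaries whose tensor product preserves the code. -/
def transversalFamilies (N : ℕ) : Set (Fin n → Op N) :=
  {v | (∀ j, v j ∈ Matrix.unitaryGroup (Fin N → Fin 2) ℂ) ∧
    Commute (transversal v) (Q.blockProj N)}

variable {N : ℕ}

theorem continuous_transversal : Continuous (transversal : (Fin n → Op N) → BlockOp N n) := by
  refine continuous_pi fun x => continuous_pi fun y => ?_
  change Continuous fun v : Fin n → Op N => ∏ j, v j (fun i => x i j) (fun i => y i j)
  exact continuous_finsetProd _ fun j _ => (continuous_apply j).matrix_elem _ _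

theorem isCompact_transversalFamilies : IsCompact (Q.transversalFamilies N) := by
  have h : Q.transversalFamilies N =
      (Set.univ.pi fun _ => (Matrix.unitaryGroup (Fin N → Fin 2) ℂ : Set (Op N))) ∩
        {v | transversal v * Q.blockProj N = Q.blockProj N * transversal v} := by
    ext v; simp [transversalFamilies, commute_iff_eq]
  rw [h]
  refine (isCompact_univ_pi fun _ => isCompact_unitaryGroup).inter_right (isClosed_eq ?_ ?_)
  · exact continuous_transversal.mul continuous_const
  · exact continuous_const.mul continuous_transversal

variable {Q}

theorem one_mem_transversalFamilies : 1 ∈ Q.transversalFamilies N :=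
  ⟨fun _ => one_mem _, by rw [transversal_one]; exact Commute.one_left _⟩

theorem mul_mem_transversalFamilies {v w : Fin n → Op N} (hv : v ∈ Q.transversalFamilies N)
    (hw : w ∈ Q.transversalFamilies N) : v * w ∈ Q.transversalFamilies N :=
  ⟨fun j => mul_mem (hv.1 j) (hw.1 j), by rw [← transversal_mul]; exact hv.2.mul_left hw.2⟩

theorem transversal_star_mul_self {v : Fin n → Op N} (hv : v ∈ Q.transversalFamilies N) :
    transversal (star v) * transversal v = 1 := by
  have : star v * v = 1 := funext fun j => Matrix.mem_unitaryGroup_iff'.1 (hv.1 j)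
  rw [transversal_mul, this, transversal_one]

theorem transversal_mul_star_self {v : Fin n → Op N} (hv : v ∈ Q.transversalFamilies N) :
    transversal v * transversal (star v) = 1 := by
  have : v * star v = 1 := funext fun j => Matrix.mem_unitaryGroup_iff.1 (hv.1 j)
  rw [transversal_mul, this, transversal_one]

theorem star_mem_transversalFamilies {v : Fin n → Op N} (hv : v ∈ Q.transversalFamilies N) :
    star v ∈ Q.transversalFamilies N := by
  refine ⟨fun j => Unitary.star_mem (hv.1 j), ?_⟩
  let u : (BlockOp N n)ˣ :=
    ⟨transversal v, transversal (star v), transversal_mul_star_self hv, transversal_star_mul_self hv⟩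
  have : Commute (u : BlockOp N n) (Q.blockProj N) := hv.2
  exact this.units_inv_left

theorem exists_transversalFamilies_of_place {r : ℕ} {U : BlockOp r n}
    (hU : U ∈ Q.transversalGates r) (e : Fin r ↪ Fin N) :
    ∃ v ∈ Q.transversalFamilies N, place e U = transversal v := by
  obtain ⟨⟨-, hUP⟩, u, hu, rfl⟩ := hU
  refine ⟨fun j => expand e (u j), ⟨fun j => expand_mem_unitaryGroup e (hu j).1, ?_⟩,
    place_transversal e u⟩
  rw [← place_transversal, place_eq_expand]
  exact commute_expand_kron_const e hUP

/-- Extending a gate by the identity on other blocks keeps it a tensor product over qubit positions,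
so a circuit of any length collapses to one element of a fixed compact group. -/
theorem exists_transversalFamilies_of_list {r : ℕ} (l : List (BlockOp N n))
    (hl : ∀ V ∈ l, ∃ (e : Fin r ↪ Fin N) (U : BlockOp r n), U ∈ Q.transversalGates r ∧
      V = place e U) : ∃ v ∈ Q.transversalFamilies N, l.prod = transversal v := by
  induction l with
  | nil => exact ⟨1, one_mem_transversalFamilies, by rw [List.prod_nil, transversal_one]⟩
  | cons V l ih =>
    obtain ⟨v, hv, hlv⟩ := ih fun V hV => hl V (List.mem_cons_of_mem _ hV)
    obtain ⟨e, U, hU, rfl⟩ := hl V List.mem_cons_self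
    obtain ⟨w, hw, hUw⟩ := exists_transversalFamilies_of_place hU e
    exact ⟨w * v, mul_mem_transversalFamilies hw hv, by
      rw [List.prod_cons, hlv, hUw, transversal_mul]⟩

/-- By compactness, approximate encoded universality is exact encoded universality. -/
theorem LogicalBasis.EncodedUniversal.exists_eq {k : ℕ} {L : Q.LogicalBasis k} {s : Fin k} {r : ℕ}
    {b : Fin N} (h : L.EncodedUniversal s (Q.transversalGates r) b)
    {u : Matrix (Fin 2) (Fin 2) ℂ} (hu : u ∈ Matrix.specialUnitaryGroup (Fin 2) ℂ) :
    ∃ (c : ℂ) (v : Fin n → Op N), ‖c‖ = 1 ∧ v ∈ Q.transversalFamilies N ∧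
      L.encodeBlock s b u * Q.blockProj N = c • (transversal v * Q.blockProj N) := by
  let f : ℂ × (Fin n → Op N) → BlockOp N n := fun x => x.1 • (transversal x.2 * Q.blockProj N)
  have hf : Continuous f :=
    continuous_fst.smul ((continuous_transversal.comp continuous_snd).mul continuous_const)
  have hc : IsClosed (f '' (Metric.sphere 0 1 ×ˢ Q.transversalFamilies N)) :=
    (((isCompact_sphere 0 1).prod Q.isCompact_transversalFamilies).image hf).isClosed
  have hmem : L.encodeBlock s b u * Q.blockProj N ∈
      f '' (Metric.sphere 0 1 ×ˢ Q.transversalFamilies N) := by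
    rw [← hc.closure_eq, Metric.mem_closure_iff]
    intro ε hε
    obtain ⟨l, c, hl, hc1, hlt⟩ := h u hu ε hε
    obtain ⟨v, hv, hlv⟩ := exists_transversalFamilies_of_list l hl
    refine ⟨_, ⟨(c, v), ⟨by simpa using hc1, hv⟩, rfl⟩, ?_⟩
    rw [dist_eq_norm]
    rwa [hlv, smul_mul_assoc] at hlt
  obtain ⟨⟨c, v⟩, ⟨hc1, hv⟩, he⟩ := hmem
  exact ⟨c, v, by simpa using hc1, hv, he.symm⟩

/-- If all rotations generated by `M` are transversal on the code, then some non-trivial one is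
given by a transversal operator near the identity. -/
theorem exists_rotation_eq_transversal_mem_nhds {M : BlockOp N n} (hM : M * M = 1)
    (hMP : Commute M (Q.blockProj N))
    (h : ∀ t : ℝ, ∃ (c : ℂ) (v : Fin n → Op N), ‖c‖ = 1 ∧ v ∈ Q.transversalFamilies N ∧
      rotation M t * Q.blockProj N = c • (transversal v * Q.blockProj N))
    {W : Set (Fin n → Op N)} (hW : W ∈ 𝓝 1) :
    ∃ t : ℝ, Real.sin t ≠ 0 ∧ ∃ (c : ℂ), ∃ v ∈ W, v ∈ Q.transversalFamilies N ∧
      rotation M t * Q.blockProj N = c • (transversal v * Q.blockProj N) := by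
  -- Any sequence of distinct angles in an interval shorter than `π` would serve.
  choose c v hc hv he using fun m : ℕ => h (1 / ((m : ℝ) + 1))
  obtain ⟨a, ha, φ, hφ, hlim⟩ := Q.isCompact_transversalFamilies.tendsto_subseq hv
  have haa : star a * a = 1 := funext fun j => Matrix.mem_unitaryGroup_iff'.1 (ha.1 j)
  -- The limit `a` need not be `1`, but the quotient of consecutive terms tends to `star a * a = 1`.
  have hlim' : Tendsto (fun m => star (v (φ m)) * v (φ (m + 1))) atTop (𝓝 1) := by
    rw [← haa]
    exact ((continuous_star.tendsto a).comp hlim).mul (hlim.comp (tendsto_add_atTop_nat 1))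
  obtain ⟨m, hm⟩ := (hlim'.eventually hW).exists
  set i := φ m
  set j := φ (m + 1)
  have hij : i < j := hφ (Nat.lt_succ_self m)
  set s : ℝ := 1 / ((i : ℝ) + 1) with hs
  set t : ℝ := 1 / ((j : ℝ) + 1) with ht
  have hts : t < s :=
    one_div_lt_one_div_of_lt (by positivity) (by exact_mod_cast Nat.succ_lt_succ hij)
  have ht0 : 0 < t := by positivity
  have hs1 : s ≤ 1 := by
    rw [hs, div_le_one (by positivity)]
    exact le_add_of_nonneg_left (Nat.cast_nonneg i)
  -- Since `0 < t < s ≤ 1`, the angle lies in `(-1, 0)`, where the sine is negative.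
  refine ⟨-s + t, (Real.sin_neg_of_neg_of_neg_pi_lt (by linarith)
    (by linarith [Real.pi_gt_three])).ne, (c i)⁻¹ * c j, _, hm,
    mul_mem_transversalFamilies (star_mem_transversalFamilies (hv i)) (hv j), ?_⟩
  set P := Q.blockProj N
  have hci : c i ≠ 0 := norm_ne_zero_iff.1 (by rw [hc i]; exact one_ne_zero)
  have h1 : transversal (star (v i)) * (rotation M s * P) = c i • P := by
    rw [he i, mul_smul_comm, ← mul_assoc, transversal_star_mul_self (hv i), one_mul]
  have h2 : transversal (star (v i)) * P = c i • (rotation M (-s) * P) := by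
    calc transversal (star (v i)) * P
        = transversal (star (v i)) * (rotation M s * P) * rotation M (-s) := by
          rw [mul_assoc, mul_assoc, ← (commute_rotation hMP (-s)).eq, ← mul_assoc (rotation M s),
            rotation_mul_rotation hM, add_neg_cancel, rotation_zero, one_mul]
      _ = _ := by rw [h1, smul_mul_assoc, (commute_rotation hMP (-s)).eq]
  calc rotation M (-s + t) * P = rotation M (-s) * P * (rotation M t * P) := by
        rw [mul_assoc, ← mul_assoc P, ← (commute_rotation hMP t).eq, mul_assoc (rotation M t),
          Q.blockProj_mul_blockProj, ← mul_assoc, rotation_mul_rotation hM]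
    _ = ((c i)⁻¹ • (transversal (star (v i)) * P)) * (c j • (transversal (v j) * P)) := by
        rw [h2, smul_smul, inv_mul_cancel₀ hci, one_smul, he j]
    _ = ((c i)⁻¹ * c j) • (transversal (star (v i) * v j) * P) := by
        rw [smul_mul_smul_comm, mul_assoc (transversal (star (v i))), ← mul_assoc P,
          ← (hv j).2.eq, mul_assoc (transversal (v j)), Q.blockProj_mul_blockProj, ← mul_assoc,
          transversal_mul]

theorem commute_site_blockProj (b : Fin N) {A : Op n} (h : Commute A Q.proj) :
    Commute (site b A) (Q.blockProj N) := by
  rw [commute_iff_eq, blockProj, site_mul_kron, kron_mul_site, h.eq]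

/-! ### Logical rotations and the contradiction -/

namespace LogicalBasis

variable {k : ℕ} (L : Q.LogicalBasis k) (s : Fin k)

theorem encodeBlock_diag (b : Fin N) (t : ℝ) :
    L.encodeBlock s b !![(Real.cos t : ℂ) + Complex.I * Real.sin t, 0;
      0, Real.cos t - Complex.I * Real.sin t] = rotation (site b (L.Z s)) t := by
  rw [← map_rotation]
  change site b (L.encode s _) = _
  congr 1
  simp only [LogicalBasis.encode, StabCode.rotation, Matrix.of_apply, Matrix.cons_val',
    Matrix.cons_val_zero, Matrix.cons_val_one, Matrix.cons_val_fin_one]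
  module

theorem encodeBlock_offDiag (b : Fin N) (t : ℝ) :
    L.encodeBlock s b !![(Real.cos t : ℂ), Complex.I * Real.sin t;
      Complex.I * Real.sin t, Real.cos t] = rotation (site b (L.X s)) t := by
  rw [← map_rotation]
  change site b (L.encode s _) = _
  congr 1
  simp only [LogicalBasis.encode, StabCode.rotation, Matrix.of_apply, Matrix.cons_val',
    Matrix.cons_val_zero, Matrix.cons_val_one, Matrix.cons_val_fin_one]
  module

/-- Transversal gates are not encoded universal for any logical qubit of a stabilizer code without
trivially encoded qubits. -/
theorem not_encodedUniversal_transversalGates (hTriv : Q.FreeOfTriviallyEncodedQubits) (r : ℕ)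
    (b : Fin N) : ¬ L.EncodedUniversal s (Q.transversalGates r) b := by
  intro h
  obtain ⟨W, hW, hcomm⟩ := Q.exists_nhds_one_commute (N := N) hTriv
  have hX2 : site b (L.X s) * site b (L.X s) = 1 := by rw [← map_mul, L.X_sq, map_one]
  have hZ2 : site b (L.Z s) * site b (L.Z s) = 1 := by rw [← map_mul, L.Z_sq, map_one]
  have hXP := commute_site_blockProj b (Q.commute_proj (L.X_centralizes s))
  have hZP := commute_site_blockProj b (Q.commute_proj (L.Z_centralizes s))
  obtain ⟨t, ht, c, v, hvW, hv, hvt⟩ := exists_rotation_eq_transversal_mem_nhds hX2 hXP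
    (fun t => by
      rw [← L.encodeBlock_offDiag s b t]; exact h.exists_eq (offDiag_mem_specialUnitaryGroup t)) hW
  obtain ⟨t', ht', c', v', hvW', hv', hvt'⟩ := exists_rotation_eq_transversal_mem_nhds hZ2 hZP
    (fun t => by
      rw [← L.encodeBlock_diag s b t]; exact h.exists_eq (diag_mem_specialUnitaryGroup t)) hW
  refine Q.blockProj_ne_zero (eq_zero_of_commute_rotation hX2 hZ2 ?_ Q.blockProj_mul_blockProj
    hXP hZP ht ht' ?_)
  · rw [← map_mul, L.XZ_anticomm, map_neg, map_mul]
  · rw [hvt, hvt']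
    exact ((hcomm v hvW v' hvW' hv.2 hv'.2).smul_left c).smul_right c'

end LogicalBasis

end StabilizerCode

end

theorem mainTheorem1 {n k : ℕ} (Q : StabilizerCode n) (hBell : Q.FreeOfBellPairs)
    (hTriv : Q.FreeOfTriviallyEncodedQubits) (L : Q.LogicalBasis k) (s : Fin k)
    (r : ℕ) (hr : 1 ≤ r) (N : ℕ) (b : Fin N) :
    ¬ L.EncodedUniversal s (Q.transversalGates r) b :=
  L.not_encodedUniversal_transversalGates s hTriv r b
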